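/- A permutation is a pair $\pi=(S,P)$, where $S$ is a finite nonempty set of positive integers and $P:S\to\mathbb{N}^2$ is an injection whose image has no two points with a common $x$-coordinate or a common $y$-coordinate; its length is $|S|$. For $p,p'\in S$ and $\alpha\in\{1,2\}$ write $p<^\pi_\alpha p'$ if the $\alpha$-th coordinate of $P(p)$ is smaller than that of $P(p')$. A permutation $\sigma$ is a subpattern of $\pi$ if there is a map $\phi:S(\sigma)\to S(\pi)$ with $p<^\sigma_\alpha p'\iff\phi(p)<^\pi_\alpha\phi(p')$ for all $p,p'\in S(\sigma)$ and $\alpha\in\{1,2\}$. Intervals are nonempty and discrete, $[p,q]=\{p,p+1,\dots,q\}\subseteq\mathbb{N}$, and a rectangle is a product $I\times J$ of two intervals. Define three measures of $\pi$. (1) $g(\pi)$ is the largest $r$ such that $\pi$ contains an $r\times r$-grid, i.e. such that there are a rectangle $I\times J$ and partitions of $I$ into intervals $I_1<\dots<I_r$ and of $J$ into intervals $J_1<\dots<J_r$ such that every cell $I_x\times J_y$ contains a point of $P(S)$. (2) $d(\pi)$ is the smallest positive integer $d$ such that every subpattern $\sigma$ of $\pi$ of length at least $2$ has a $d$-close pair,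 i.e. two distinct elements $p,p'\in S(\sigma)$ such that for each $\alpha\in\{1,2\}$ fewer than $d$ elements of $S(\sigma)$ lie strictly between $p$ and $p'$ with respect to $<^\sigma_\alpha$. (3) $w(\pi)$ is the smallest $d$ such that $\pi$ has a $d$-wide decomposition. Here a decomposition is a sequence of indexed families of rectangles $\mathcal{R}_0,\dots,\mathcal{R}_s$, where $\mathcal{R}_0$ is $\pi$ (each point seen as a degenerate rectangle), each $\mathcal{R}_p$ with $1\le p\le s$ arises from $\mathcal{R}_{p-1}$ by replacing two rectangles with distinct indices by their bounding box, which gets a new index $k_p$, where $\max S<k_1<\dots<k_s$, and $\mathcal{R}_s$ consists of a single rectangle. It is $d$-wide if in every $\mathcal{R}_p$, for every rectangle $R$ and each $\alpha\in\{1,2\}$, fewer than $d$ other rectangles of $\mathcal{R}_p$ have an $\alpha$-th interval that intersects the $\alpha$-th interval of $R$. Call two measures $m,m'$ equivalent if there are increasing functions $f,h:\mathbb{N}\to\mathbb{N}$ such that $m(\pi)\le f(m'(\pi))$ and $m'(\pi)\le h(m(\pi))$ for every permutation $\pi$. Then $g$, $d$ and $w$ are well defined and pairwise equivalent. Moreover,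 $d(\pi)\le w(\pi)$ and $g(\pi)<5\,d(\pi)$ for every permutation $\pi$. -/

import Mathlib

namespace PermPattern

/-- A point of `ℕ²`; coordinate `0` is the `x`-coordinate, coordinate `1` the `y`-coordinate. -/
abbrev Point : Type := Fin 2 → ℕ

/-- A permutation as a labelled point set in general position: a finite set `S` of positive
integers and a map `P` placing the elements of `S` in `ℕ²`, such that no two distinct elements of
`S` share a coordinate. `P` is total for convenience; only its values on `S` are ever used. -/
structure Permutation where
  S : Finset ℕ
  P : ℕ → Point
  pos : ∀ i ∈ S, 0 < i
  general : ∀ α : Fin 2, Set.InjOn (fun i => P i α) (S : Set ℕ)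

/-- The length `|π|`. -/
def Permutation.length (π : Permutation) : ℕ := π.S.card

/-- `p <^π_α p'`. -/
def Permutation.lt (π : Permutation) (α : Fin 2) (p p' : ℕ) : Prop := π.P p α < π.P p' α

/-- `φ` is an embedding of `σ` into `π`. -/
def IsEmbedding (σ π : Permutation) (φ : ℕ → ℕ) : Prop :=
  (∀ p ∈ σ.S, φ p ∈ π.S) ∧
    ∀ p ∈ σ.S, ∀ p' ∈ σ.S, ∀ α : Fin 2, σ.lt α p p' ↔ π.lt α (φ p) (φ p')

/-- `σ` is a subpattern of `π`. -/
def IsSubpattern (σ π : Permutation) : Prop := ∃ φ : ℕ → ℕ, IsEmbedding σ π φ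

/-! ### Close pairs -/

open Classical in
/-- `Int_α(π, p, p')`: the elements strictly between `p` and `p'` for `<^π_α`. -/
noncomputable def Permutation.between (π : Permutation) (α : Fin 2) (p p' : ℕ) : Finset ℕ :=
  π.S.filter fun q => (π.lt α p q ∧ π.lt α q p') ∨ (π.lt α p' q ∧ π.lt α q p)

/-- The two distinct elements `p, p'` of `S(π)` form a `d`-close pair of `π`. -/
def IsClosePair (d : ℕ) (π : Permutation) (p p' : ℕ) : Prop :=
  p ∈ π.S ∧ p' ∈ π.S ∧ p ≠ p' ∧ ∀ α : Fin 2, (π.between α p p').card < d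

/-- `π` has a `d`-close pair. -/
def HasClosePair (d : ℕ) (π : Permutation) : Prop := ∃ p p' : ℕ, IsClosePair d π p p'

/-- Every subpattern of `π` (with at least two elements, so that it has a pair at all) has a
`d`-close pair. -/
def HereditarilyClose (d : ℕ) (π : Permutation) : Prop :=
  ∀ σ : Permutation, IsSubpattern σ π → 2 ≤ σ.length → HasClosePair d σ

/-! ### Rectangle families and decompositions -/

/-- An axis-parallel rectangle, given by its two (nonempty, discrete) intervals `I_α(R)`.
The order is inclusion, and `R ⊔ R'` is the bounding box of `R` and `R'`. -/
abbrev Rect : Type := Fin 2 → NonemptyInterval ℕ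

/-- A rectangle family `(S, R)` with finite index set; only the values of `R` on `S` matter. -/
structure RectFamily where
  S : Finset ℕ
  R : ℕ → Rect

/-- A permutation viewed as a family of degenerate rectangles. -/
def Permutation.toFamily (π : Permutation) : RectFamily where
  S := π.S
  R := fun i α => NonemptyInterval.pure (π.P i α)

/-- The family `𝓡[i, j → k]`: rectangles `i` and `j` are replaced by their bounding box, which gets
the index `k`. -/
def RectFamily.merge (F : RectFamily) (i j k : ℕ) : RectFamily where
  S := insert k (F.S \ {i, j})
  R := Function.update F.R k (F.R i ⊔ F.R j)

/-- `fam 0, …, fam s` is a decomposition of `π`. -/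
def IsDecomposition (π : Permutation) (s : ℕ) (fam : Fin (s + 1) → RectFamily) : Prop :=
  fam 0 = π.toFamily ∧
  (∃ k : Fin s → ℕ, StrictMono k ∧ (∀ p : Fin s, ∀ i ∈ π.S, i < k p) ∧
    ∀ p : Fin s, ∃ i ∈ (fam p.castSucc).S, ∃ j ∈ (fam p.castSucc).S, i ≠ j ∧
      fam p.succ = (fam p.castSucc).merge i j (k p)) ∧
  (fam (Fin.last s)).S.card = 1

/-- Two rectangles `α`-view each other if their `α`-th intervals intersect. -/
def Rect.Views (α : Fin 2) (A B : Rect) : Prop := ((A α : Set ℕ) ∩ (B α : Set ℕ)).Nonempty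

open Classical in
/-- `view_α(𝓡, i)`. -/
noncomputable def RectFamily.viewSet (F : RectFamily) (α : Fin 2) (i : ℕ) : Finset ℕ :=
  (F.S.erase i).filter fun j => Rect.Views α (F.R i) (F.R j)

/-- `view(𝓡, i)`: the maximum of the cardinalities of `view_1(𝓡, i)` and `view_2(𝓡, i)`. -/
noncomputable def RectFamily.view (F : RectFamily) (i : ℕ) : ℕ :=
  max (F.viewSet 0 i).card (F.viewSet 1 i).card

/-- The rectangle family is `d`-wide. -/
def RectFamily.IsWide (F : RectFamily) (d : ℕ) : Prop := ∀ i ∈ F.S, F.view i < d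

/-- `π` has a `d`-wide decomposition. -/
def HasWideDecomposition (d : ℕ) (π : Permutation) : Prop :=
  ∃ (s : ℕ) (fam : Fin (s + 1) → RectFamily),
    IsDecomposition π s fam ∧ ∀ p, (fam p).IsWide d

/-! ### Grids -/

/-- `(Q 0, …, Q (s-1))` is a partition of the interval `I` into consecutive intervals. -/
def IsIntervalPartition (I : NonemptyInterval ℕ) {s : ℕ} (Q : Fin s → NonemptyInterval ℕ) : Prop :=
  (Pairwise fun a b => Disjoint (Q a : Set ℕ) (Q b : Set ℕ)) ∧
  (⋃ a, (Q a : Set ℕ)) = (I : Set ℕ) ∧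
  ∀ a b : Fin s, a < b → (Q a).snd < (Q b).fst

/-- The point set `M` contains an `r × s`-grid: some rectangle has an `r × s`-gridding all of whose
cells meet `M`. -/
def ContainsGrid (M : Set Point) (r s : ℕ) : Prop :=
  ∃ (B : Rect) (C : Fin r → NonemptyInterval ℕ) (D : Fin s → NonemptyInterval ℕ),
    IsIntervalPartition (B 0) C ∧ IsIntervalPartition (B 1) D ∧
    ∀ (x : Fin r) (y : Fin s), ∃ p ∈ M, p 0 ∈ (C x : Set ℕ) ∧ p 1 ∈ (D y : Set ℕ)

/-- The permutation `π` contains an `r × s`-grid. -/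
def Permutation.ContainsGrid (π : Permutation) (r s : ℕ) : Prop :=
  PermPattern.ContainsGrid (π.P '' (π.S : Set ℕ)) r s

/-! ### The three measures -/

/-- `g(π)`: the largest `r` such that `π` contains an `r × r`-grid. -/
noncomputable def gridMeasure (π : Permutation) : ℕ := sSup {r | π.ContainsGrid r r}

/-- `d(π)`: the smallest positive integer `d` such that every subpattern of `π` has a `d`-close
pair. (A close pair needs `d ≥ 1`; positivity is only of effect when `π` has no pair at all.) -/
noncomputable def closeMeasure (π : Permutation) : ℕ := sInf {d | 0 < d ∧ HereditarilyClose d π}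

/-- `w(π)`: the width, i.e. the smallest `d` such that `π` has a `d`-wide decomposition. -/
noncomputable def width (π : Permutation) : ℕ := sInf {d | HasWideDecomposition d π}

/-- Two measures of (nonempty) permutations are equivalent if each is bounded by an increasing
function of the other. -/
def EquivalentMeasures (m m' : Permutation → ℕ) : Prop :=
  ∃ f g : ℕ → ℕ, StrictMono f ∧ StrictMono g ∧
    ∀ π : Permutation, 1 ≤ π.length → m π ≤ f (m' π) ∧ m' π ≤ g (m π)

end PermPattern

namespace PermPattern

/-! The three measures are compared in a cycle: `g < 5 d`, `d ≤ w`, and `w ≤ H(g)` for an increasing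
`H`. The last bound makes `w` finite, which makes `d` finite, and all the equivalences follow by
composing the three inequalities.

For `g < 5 d` (`five_mul_not_containsGrid`), a large grid contains a sparse sublattice of cells in
which any two points are separated, along some axis, by a whole row or column of at least `d`
points.

For `d ≤ w` (`HasWideDecomposition.hereditarilyClose`), run a wide decomposition of `π` until two
points of a subpattern first share a rectangle. Every point of the subpattern between them lies in
its own rectangle viewed by the merged one, so these two points are close.

For `w ≤ H(g)` (`IsDivided.canFinish`), keep the axes divided into strips of bounded load. Two
rectangles in a common cell are merged. If no cell holds two, the occupied cells form a matrix
without a large grid minor, so by Marcus–Tardos their number is linear in the number of strips;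
averaging then gives two adjacent strips that can be joined without exceeding the load. -/

theorem Permutation.mem_between {π : Permutation} {α : Fin 2} {p p' q : ℕ} :
    q ∈ π.between α p p' ↔ q ∈ π.S ∧
      ((π.P p α < π.P q α ∧ π.P q α < π.P p' α) ∨ (π.P p' α < π.P q α ∧ π.P q α < π.P p α)) := by
  classical
  exact Finset.mem_filter

theorem RectFamily.mem_viewSet {F : RectFamily} {α : Fin 2} {i j : ℕ} :
    j ∈ F.viewSet α i ↔ (j ≠ i ∧ j ∈ F.S) ∧ Rect.Views α (F.R i) (F.R j) := by
  classical
  exact Finset.mem_filter.trans (and_congr_left' Finset.mem_erase)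

theorem Rect.mem_sup_left {A B : Rect} {α : Fin 2} {x : ℕ} (h : x ∈ A α) : x ∈ (A ⊔ B) α :=
  ⟨(inf_le_left (b := (B α).fst)).trans h.1, h.2.trans (le_sup_left (b := (B α).snd))⟩

theorem Rect.mem_sup_right {A B : Rect} {α : Fin 2} {x : ℕ} (h : x ∈ B α) : x ∈ (A ⊔ B) α :=
  ⟨(inf_le_right (a := (A α).fst)).trans h.1, h.2.trans (le_sup_right (a := (A α).snd))⟩

/-! ### Grid minors and the Marcus–Tardos theorem -/

/-- The set `M` admits monotone maps of the two coordinates under which its image contains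
`{0, …, r - 1} × {0, …, r - 1}`. -/
def HasGridMinor (M : Set (ℕ × ℕ)) (r : ℕ) : Prop :=
  ∃ u v : ℕ → ℕ, Monotone u ∧ Monotone v ∧
    ∀ i < r, ∀ j < r, ∃ p ∈ M, u p.1 = i ∧ v p.2 = j

theorem HasGridMinor.of_image {M : Set (ℕ × ℕ)} {r : ℕ} {f g : ℕ → ℕ} (hf : Monotone f)
    (hg : Monotone g) (h : HasGridMinor (Prod.map f g '' M) r) : HasGridMinor M r := by
  obtain ⟨u, v, hu, hv, h⟩ := h
  refine ⟨u ∘ f, v ∘ g, hu.comp hf, hv.comp hg, fun i hi j hj => ?_⟩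
  obtain ⟨_, ⟨p, hp, rfl⟩, h1, h2⟩ := h i hi j hj
  exact ⟨p, hp, h1, h2⟩

theorem HasGridMinor.of_swap {M : Set (ℕ × ℕ)} {r : ℕ}
    (h : HasGridMinor (Prod.swap '' M) r) : HasGridMinor M r := by
  obtain ⟨u, v, hu, hv, h⟩ := h
  refine ⟨v, u, hv, hu, fun i hi j hj => ?_⟩
  obtain ⟨_, ⟨p, hp, rfl⟩, h1, h2⟩ := h j hj i hi
  exact ⟨p, hp, h2, h1⟩

theorem exists_mem_count_eq (T : Finset ℕ) {i : ℕ} (hi : i < T.card) :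
    ∃ x ∈ T, Nat.count (· ∈ T) x = i := by
  have hlt : ∀ hf : {x | x ∈ T}.Finite, i < hf.toFinset.card := fun hf => by
    have : hf.toFinset = T := by ext; simp
    rwa [this]
  exact ⟨Nat.nth (· ∈ T) i, Nat.nth_mem i hlt, Nat.count_nth hlt⟩

/-- A product-like pattern of large enough size, the second coordinate being read in blocks of
length `s`, yields a grid minor. -/
theorem HasGridMinor.of_product {M : Set (ℕ × ℕ)} {r s : ℕ} (T B : Finset ℕ) (hT : r ≤ T.card)
    (hB : r ≤ B.card) (h : ∀ x ∈ T, ∀ b ∈ B, ∃ y, (x, y) ∈ M ∧ y / s = b) :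
    HasGridMinor M r := by
  refine ⟨Nat.count (· ∈ T), fun y => Nat.count (· ∈ B) (y / s), Nat.count_monotone _,
    fun a b hab => Nat.count_monotone _ (Nat.div_le_div_right hab), fun i hi j hj => ?_⟩
  obtain ⟨x, hx, rfl⟩ := exists_mem_count_eq T (hi.trans_le hT)
  obtain ⟨b, hb, rfl⟩ := exists_mem_count_eq B (hj.trans_le hB)
  obtain ⟨y, hy, rfl⟩ := h x hx b hb
  exact ⟨_, hy, rfl, rfl⟩

/-- The entries of `M` in the `s × s`-block with index `c`. -/
def block (M : Finset (ℕ × ℕ)) (s : ℕ) (c : ℕ × ℕ) : Finset (ℕ × ℕ) :=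
  M.filter fun p => Prod.map (· / s) (· / s) p = c

/-- The entries lying in blocks with at least `r` nonempty columns. -/
def wideEntries (M : Finset (ℕ × ℕ)) (r s : ℕ) : Finset (ℕ × ℕ) :=
  M.filter fun p => r ≤ ((block M s (Prod.map (· / s) (· / s) p)).image Prod.fst).card

theorem mem_Ico_of_div_eq {s a x : ℕ} (hs : 0 < s) (h : x / s = a) :
    x ∈ Finset.Ico (a * s) (a * s + s) := by
  subst h
  have h1 := Nat.div_add_mod x s
  have h2 := Nat.mod_lt x hs
  rw [mul_comm] at h1
  rw [Finset.mem_Ico]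
  omega

theorem block_subset (M : Finset (ℕ × ℕ)) {s : ℕ} (hs : 0 < s) (c : ℕ × ℕ) :
    block M s c ⊆ Finset.Ico (c.1 * s) (c.1 * s + s) ×ˢ Finset.Ico (c.2 * s) (c.2 * s + s) := by
  intro p hp
  obtain ⟨-, rfl⟩ := Finset.mem_filter.1 hp
  exact Finset.mem_product.2 ⟨mem_Ico_of_div_eq hs rfl, mem_Ico_of_div_eq hs rfl⟩

/-- Pigeonhole in one vertical strip of blocks: a wide block is assigned its set of nonempty
columns, one of at most `2 ^ s` sets. More than `r * 2 ^ s` wide blocks would give more than `r`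
with the same column set, which is a product pattern and hence a grid minor. Each block has at most
`s * s` entries, and there are `N` strips. -/
theorem card_wideEntries_le {M : Finset (ℕ × ℕ)} {r s N : ℕ} (hs : 0 < s)
    (hN : ∀ p ∈ M, p.1 / s < N) (hM : ¬ HasGridMinor (M : Set (ℕ × ℕ)) r) :
    (wideEntries M r s).card ≤ s * s * (r * 2 ^ s * N) := by
  set q : ℕ × ℕ → ℕ × ℕ := Prod.map (· / s) (· / s) with hq
  have h1 : (wideEntries M r s).card ≤ s * s * ((wideEntries M r s).image q).card := by
    refine Finset.card_le_mul_card_image _ _ fun c _ => ?_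
    refine (Finset.card_le_card (t := block M s c) fun p hp => ?_).trans
      ((Finset.card_le_card (block_subset M hs c)).trans (by simp))
    obtain ⟨hp, hc⟩ := Finset.mem_filter.1 hp
    exact Finset.mem_filter.2 ⟨(Finset.mem_filter.1 hp).1, hc⟩
  have h2 : ((wideEntries M r s).image q).card ≤
      r * 2 ^ s * (((wideEntries M r s).image q).image Prod.fst).card := by
    refine Finset.card_le_mul_card_image _ _ fun a _ => ?_
    by_contra! hlt
    set W := ((wideEntries M r s).image q).filter (fun c => c.1 = a) with hW
    have hwide : ∀ c ∈ W, c.1 = a ∧ r ≤ ((block M s c).image Prod.fst).card := by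
      intro c hc
      obtain ⟨hc, ha⟩ := Finset.mem_filter.1 hc
      obtain ⟨p, hp, rfl⟩ := Finset.mem_image.1 hc
      exact ⟨ha, (Finset.mem_filter.1 hp).2⟩
    have hmaps : ∀ c ∈ W, (block M s c).image Prod.fst ∈
        (Finset.Ico (a * s) (a * s + s)).powerset := by
      intro c hc
      obtain ⟨rfl, -⟩ := hwide c hc
      rw [Finset.mem_powerset]
      intro x hx
      obtain ⟨p, hp, rfl⟩ := Finset.mem_image.1 hx
      exact (Finset.mem_product.1 (block_subset M hs c hp)).1
    obtain ⟨T, -, hT⟩ := Finset.exists_lt_card_fiber_of_mul_lt_card_of_maps_to hmaps (n := r)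
      (by simpa [mul_comm] using hlt)
    set V := W.filter (fun c => (block M s c).image Prod.fst = T) with hV
    have hVW : ∀ c ∈ V, c ∈ W ∧ (block M s c).image Prod.fst = T := fun c hc =>
      Finset.mem_filter.1 hc
    have hinj : Set.InjOn Prod.snd (V : Set (ℕ × ℕ)) := by
      intro c hc c' hc' h
      exact Prod.ext ((hwide c (hVW c hc).1).1.trans (hwide c' (hVW c' hc').1).1.symm) h
    obtain ⟨c₀, hc₀⟩ := Finset.card_pos.1 (Nat.zero_lt_of_lt hT)
    refine hM (HasGridMinor.of_product (s := s) T (V.image Prod.snd) ?_ ?_ ?_)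
    · rw [← (hVW c₀ hc₀).2]
      exact (hwide c₀ (hVW c₀ hc₀).1).2
    · rw [Finset.card_image_of_injOn hinj]
      exact hT.le
    · intro x hx b hb
      obtain ⟨c, hc, rfl⟩ := Finset.mem_image.1 hb
      rw [← (hVW c hc).2] at hx
      obtain ⟨p, hp, rfl⟩ := Finset.mem_image.1 hx
      obtain ⟨hpM, hpc⟩ := Finset.mem_filter.1 hp
      exact ⟨p.2, hpM, by rw [← hpc]; rfl⟩
  have h3 : (((wideEntries M r s).image q).image Prod.fst).card ≤ N := by
    refine (Finset.card_le_card (t := Finset.range N) fun a ha => ?_).trans (by simp)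
    obtain ⟨c, hc, rfl⟩ := Finset.mem_image.1 ha
    obtain ⟨p, hp, rfl⟩ := Finset.mem_image.1 hc
    exact Finset.mem_range.2 (hN p (Finset.mem_filter.1 hp).1)
  exact h1.trans (Nat.mul_le_mul_left _ (h2.trans (Nat.mul_le_mul_left _ h3)))

theorem block_image_swap (M : Finset (ℕ × ℕ)) (s : ℕ) (c : ℕ × ℕ) :
    block (M.image Prod.swap) s c.swap = (block M s c).image Prod.swap := by
  ext ⟨x, y⟩
  simp [block, Prod.ext_iff, and_comm]

/-- The Marcus–Tardos recursion. Blocks with at least `r` nonempty rows are wide blocks of the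
transpose, so wide and tall blocks together account for the second term. Any other nonempty block
has fewer than `r` nonempty rows and columns, hence at most `r * r` entries. -/
theorem card_le_of_not_hasGridMinor {M : Finset (ℕ × ℕ)} {r s N : ℕ} (hs : 0 < s)
    (hN : ∀ p ∈ M, p.1 / s < N ∧ p.2 / s < N) (hM : ¬ HasGridMinor (M : Set (ℕ × ℕ)) r) :
    M.card ≤ r * r * (M.image (Prod.map (· / s) (· / s))).card +
      2 * (s * s * (r * 2 ^ s * N)) := by
  set M' := M.image Prod.swap with hM'
  have hA := card_wideEntries_le hs (fun p hp => (hN p hp).1) hM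
  have hB : (wideEntries M' r s).card ≤ s * s * (r * 2 ^ s * N) := by
    refine card_wideEntries_le hs ?_ ?_
    · intro p hp
      obtain ⟨p', hp', rfl⟩ := Finset.mem_image.1 hp
      exact (hN p' hp').2
    · intro h
      refine hM (HasGridMinor.of_swap ?_)
      rwa [hM', Finset.coe_image] at h
  set A := wideEntries M r s
  set B := (wideEntries M' r s).image Prod.swap
  have hB' : B.card ≤ (wideEntries M' r s).card := Finset.card_image_le
  have hE : ((M \ A) \ B).card ≤ r * r * (M.image (Prod.map (· / s) (· / s))).card := by
    refine (Finset.card_le_mul_card_image (f := Prod.map (· / s) (· / s)) _ (r * r) ?_).trans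
      (Nat.mul_le_mul_left _ (Finset.card_le_card (Finset.image_subset_image
        (Finset.sdiff_subset.trans Finset.sdiff_subset))))
    intro c hc
    obtain ⟨p, hp, rfl⟩ := Finset.mem_image.1 hc
    obtain ⟨hp, hpB⟩ := Finset.mem_sdiff.1 hp
    obtain ⟨hpM, hpA⟩ := Finset.mem_sdiff.1 hp
    set c : ℕ × ℕ := Prod.map (· / s) (· / s) p with hc
    have h1 : ((block M s c).image Prod.fst).card < r := by
      by_contra! h
      exact hpA (Finset.mem_filter.2 ⟨hpM, h⟩)
    have h2 : ((block M s c).image Prod.snd).card < r := by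
      by_contra! h
      refine hpB (Finset.mem_image.2 ⟨p.swap, Finset.mem_filter.2
        ⟨Finset.mem_image_of_mem _ hpM, ?_⟩, p.swap_swap⟩)
      have : (Prod.map (· / s) (· / s) p.swap : ℕ × ℕ) = c.swap := rfl
      rw [this, block_image_swap, Finset.image_image]
      exact h
    refine (Finset.card_le_card (t := (block M s c).image Prod.fst ×ˢ
      (block M s c).image Prod.snd) fun x hx => ?_).trans ?_
    · obtain ⟨hx, hxc⟩ := Finset.mem_filter.1 hx
      have hxb : x ∈ block M s c := Finset.mem_filter.2
        ⟨(Finset.mem_sdiff.1 (Finset.mem_sdiff.1 hx).1).1, hxc⟩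
      exact Finset.mem_product.2 ⟨Finset.mem_image_of_mem _ hxb, Finset.mem_image_of_mem _ hxb⟩
    · rw [Finset.card_product]
      exact Nat.mul_le_mul h1.le h2.le
  have h1 := Finset.le_card_sdiff A M
  have h2 := Finset.le_card_sdiff B (M \ A)
  omega

/-- The Marcus–Tardos theorem for grid minors. -/
theorem exists_card_le_mul_of_not_hasGridMinor (r : ℕ) : ∃ C, 0 < C ∧
    ∀ (n : ℕ) (M : Finset (ℕ × ℕ)), M ⊆ Finset.range n ×ˢ Finset.range n →
      ¬ HasGridMinor (M : Set (ℕ × ℕ)) r → M.card ≤ C * n := by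
  -- The block size satisfies `4 r² ≤ s`, so that with `N s ≤ 2 n` the contracted matrix contributes
  -- at most half of the target bound.
  set s := 4 * (r + 1) ^ 2 with hsdef
  set K := 2 * (s * s * (r * 2 ^ s)) with hK
  have hs4 : 4 ≤ s := by nlinarith
  have hrs : 4 * (r * r) ≤ s := by nlinarith
  -- The summand `2 * K` lets the wide and tall blocks fit into the other half; the summand `s`
  -- settles the matrices with `n < s`.
  refine ⟨2 * K + s, by omega, fun n => ?_⟩
  induction n using Nat.strong_induction_on with
  | _ n ih =>
    intro M hMn hM
    rcases lt_or_ge n s with hn | hn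
    · have h := Finset.card_le_card hMn
      rw [Finset.card_product, Finset.card_range] at h
      exact h.trans (Nat.mul_le_mul_right _ (by omega))
    set N := n / s + 1 with hNdef
    have hNs : N * s ≤ 2 * n := by
      have := Nat.div_mul_le_self n s
      rw [hNdef, add_mul]
      omega
    have hNn : N < n := by nlinarith
    have hN : ∀ p ∈ M, p.1 / s < N ∧ p.2 / s < N := by
      intro p hp
      have h := Finset.mem_product.1 (hMn hp)
      simp only [Finset.mem_range] at h
      exact ⟨Nat.lt_succ_of_le (Nat.div_le_div_right h.1.le),
        Nat.lt_succ_of_le (Nat.div_le_div_right h.2.le)⟩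
    have h1 := card_le_of_not_hasGridMinor (by omega) hN hM
    have h2 := ih N hNn (M.image (Prod.map (· / s) (· / s))) (by
      intro c hc
      obtain ⟨p, hp, rfl⟩ := Finset.mem_image.1 hc
      simpa using hN p hp) (by
      intro h
      rw [Finset.coe_image] at h
      exact hM (HasGridMinor.of_image (fun a b hab => Nat.div_le_div_right hab)
        (fun a b hab => Nat.div_le_div_right hab) h))
    have h3 : 2 * (s * s * (r * 2 ^ s * N)) = K * N := by rw [hK]; ring
    have h4 : K * N ≤ K * n := Nat.mul_le_mul_left _ hNn.le
    have h5 : r * r * (M.image (Prod.map (· / s) (· / s))).card ≤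
        r * r * ((2 * K + s) * N) := Nat.mul_le_mul_left _ h2
    have h6 : 2 * (r * r * N) ≤ n := by nlinarith
    have h7 : 2 * (r * r * ((2 * K + s) * N)) ≤ (2 * K + s) * n := by
      calc _ = (2 * K + s) * (2 * (r * r * N)) := by ring
        _ ≤ _ := Nat.mul_le_mul_left _ h6
    nlinarith

/-! ### Wide decompositions give close pairs -/

/-- Without a close pair, the elements of the subpattern would stay in pairwise distinct rectangles
through every merge, which is impossible in the final family of one rectangle. -/
theorem HasWideDecomposition.hereditarilyClose {d : ℕ} {π : Permutation}
    (h : HasWideDecomposition d π) : HereditarilyClose d π := by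
  obtain ⟨s, fam, ⟨h0, ⟨k, hk, hkπ, hstep⟩, hlast⟩, hwide⟩ := h
  rintro σ ⟨φ, hφS, hφ⟩ hσ
  by_contra hclose
  have hφinj : ∀ t ∈ σ.S, ∀ t' ∈ σ.S, φ t = φ t' → t = t' := by
    intro t ht t' ht' he
    refine σ.general 0 ht ht' (le_antisymm ?_ ?_) <;> refine not_lt.1 fun hlt => ?_
    · exact lt_irrefl _ (show π.P (φ t) 0 < π.P (φ t) 0 from
        by have := (hφ t' ht' t ht 0).1 hlt; rwa [← he] at this)
    · exact lt_irrefl _ (show π.P (φ t) 0 < π.P (φ t) 0 from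
        by have := (hφ t ht t' ht' 0).1 hlt; rwa [← he] at this)
  -- Here `b t` is the index of the rectangle that has absorbed the image of `t`. The first conjunct
  -- says that indices still to be introduced are not yet in use.
  have key : ∀ p : Fin (s + 1),
      (∀ i ∈ (fam p).S, ∀ q : Fin s, p ≤ q.castSucc → i < k q) ∧
      ∃ b : ℕ → ℕ, (∀ t ∈ σ.S, b t ∈ (fam p).S) ∧
        (∀ t ∈ σ.S, ∀ α, π.P (φ t) α ∈ (fam p).R (b t) α) ∧ Set.InjOn b (σ.S : Set ℕ) := by
    intro p
    induction p using Fin.induction with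
    | zero =>
      rw [h0]
      exact ⟨fun i hi q _ => hkπ q i hi, φ, hφS,
        fun t _ α => NonemptyInterval.mem_pure.2 rfl, hφinj⟩
    | succ p ih =>
      obtain ⟨hfresh, b, hbS, hbR, hbinj⟩ := ih
      obtain ⟨i, hi, j, hj, hij, hm⟩ := hstep p
      have hkp : k p ∉ (fam p.castSucc).S := fun hmem =>
        lt_irrefl _ (hfresh _ hmem p le_rfl)
      have hS : (fam p.succ).S = insert (k p) ((fam p.castSucc).S \ {i, j}) := by rw [hm]; rfl
      have hRk : (fam p.succ).R (k p) = (fam p.castSucc).R i ⊔ (fam p.castSucc).R j := by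
        rw [hm]; simp [RectFamily.merge]
      have hRn : ∀ x ≠ k p, (fam p.succ).R x = (fam p.castSucc).R x := by
        intro x hx; rw [hm]; simp [RectFamily.merge, hx]
      have hne : ∀ t ∈ σ.S, b t ≠ k p := fun t ht h => hkp (h ▸ hbS t ht)
      have hmemk : ∀ t ∈ σ.S, (b t = i ∨ b t = j) → ∀ α,
          π.P (φ t) α ∈ (fam p.succ).R (k p) α := by
        intro t ht hb α
        rw [hRk]
        have h := hbR t ht α
        rcases hb with hb | hb <;> rw [hb] at h
        · exact Rect.mem_sup_left h
        · exact Rect.mem_sup_right h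
      refine ⟨?_, fun t => if b t = i ∨ b t = j then k p else b t, ?_, ?_, ?_⟩
      · intro x hx q hq
        have hpq : p < q := Fin.castSucc_lt_castSucc_iff.1
          (lt_of_lt_of_le (Fin.castSucc_lt_succ) hq)
        rw [hS, Finset.mem_insert] at hx
        rcases hx with rfl | hx
        · exact hk hpq
        · exact hfresh x (Finset.mem_sdiff.1 hx).1 q (Fin.castSucc_le_castSucc_iff.2 hpq.le)
      · intro t ht
        rw [hS]
        dsimp only
        split_ifs with hb
        · exact Finset.mem_insert_self _ _
        · push Not at hb
          exact Finset.mem_insert_of_mem (Finset.mem_sdiff.2 ⟨hbS t ht, by simp [hb]⟩)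
      · intro t ht α
        dsimp only
        split_ifs with hb
        · exact hmemk t ht hb α
        · rw [hRn _ (hne t ht)]
          exact hbR t ht α
      · intro t ht t' ht' he
        by_contra htt
        have hbb : b t ≠ b t' := fun h => htt (hbinj ht ht' h)
        dsimp only at he
        split_ifs at he with h1 h2 h2
        · refine hclose ⟨t, t', ht, ht', htt, fun α => ?_⟩
          have hw := hwide p.succ (k p) (by rw [hS]; exact Finset.mem_insert_self _ _)
          have hw' : ((fam p.succ).viewSet α (k p)).card < d := by
            refine lt_of_le_of_lt ?_ hw
            fin_cases α
            · exact le_max_left _ _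
            · exact le_max_right _ _
          refine lt_of_le_of_lt (Finset.card_le_card_of_injOn b ?_
            (hbinj.mono fun x hx => (Permutation.mem_between.1 hx).1)) hw'
          intro q hq
          obtain ⟨hqS, hq⟩ := Permutation.mem_between.1 hq
          have hqt : q ≠ t ∧ q ≠ t' := by
            constructor <;> rintro rfl <;> omega
          -- The distinct indices `b t` and `b t'` exhaust `{i, j}`, so the rectangle of a third
          -- element survives the merge.
          have hbq : b q ≠ i ∧ b q ≠ j := by
            have e1 : b q ≠ b t := fun h => hqt.1 (hbinj hqS ht h)
            have e2 : b q ≠ b t' := fun h => hqt.2 (hbinj hqS ht' h)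
            rcases h1 with h1 | h1 <;> rcases h2 with h2 | h2 <;> grind
          refine RectFamily.mem_viewSet.2 ⟨⟨hne q hqS, ?_⟩, ?_⟩
          · rw [hS]
            exact Finset.mem_insert_of_mem (Finset.mem_sdiff.2 ⟨hbS q hqS, by simp [hbq]⟩)
          · refine ⟨π.P (φ q) α, ?_, ?_⟩
            · have m1 := hmemk t ht h1 α
              have m2 := hmemk t' ht' h2 α
              rw [NonemptyInterval.mem_def] at m1 m2
              rw [SetLike.mem_coe, NonemptyInterval.mem_def]
              rcases hq with ⟨a, b⟩ | ⟨a, b⟩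
              · have a' : π.P (φ t) α < π.P (φ q) α := (hφ t ht q hqS α).1 a
                have b' : π.P (φ q) α < π.P (φ t') α := (hφ q hqS t' ht' α).1 b
                omega
              · have a' : π.P (φ t') α < π.P (φ q) α := (hφ t' ht' q hqS α).1 a
                have b' : π.P (φ q) α < π.P (φ t) α := (hφ q hqS t ht α).1 b
                omega
            · rw [hRn _ (hne q hqS)]
              exact hbR q hqS α
        · exact hne t' ht' he.symm
        · exact hne t ht he
        · exact hbb he
  obtain ⟨-, b, hbS, -, hbinj⟩ := key (Fin.last s)
  have := Finset.card_le_card_of_injOn b hbS hbinj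
  rw [hlast] at this
  exact absurd hσ (by unfold Permutation.length; omega)

/-! ### Large grids exclude close pairs -/

/-- The permutation obtained by keeping only the elements of `T`. -/
def Permutation.restrict (π : Permutation) (T : Finset ℕ) (hT : T ⊆ π.S) : Permutation where
  S := T
  P := π.P
  pos i hi := π.pos i (hT hi)
  general α := (π.general α).mono (Finset.coe_subset.2 hT)

theorem Permutation.restrict_isSubpattern (π : Permutation) (T : Finset ℕ) (hT : T ⊆ π.S) :
    IsSubpattern (π.restrict T hT) π :=
  ⟨id, hT, fun _ _ _ _ _ => Iff.rfl⟩

theorem IsIntervalPartition.lt_of_mem {I : NonemptyInterval ℕ} {r : ℕ}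
    {Q : Fin r → NonemptyInterval ℕ} (h : IsIntervalPartition I Q) {a b : Fin r} (hab : a < b)
    {x y : ℕ} (hx : x ∈ Q a) (hy : y ∈ Q b) : x < y :=
  hx.2.trans_lt ((h.2.2 a b hab).trans_le hy.1)

theorem card_le_length_of_containsGrid {π : Permutation} {r s : ℕ} (hs : 0 < s)
    (h : π.ContainsGrid r s) : r ≤ π.length := by
  obtain ⟨B, C, D, hC, hD, hcell⟩ := h
  have hp : ∀ x : Fin r, ∃ i ∈ π.S, π.P i 0 ∈ C x := by
    intro x
    obtain ⟨_, ⟨i, hi, rfl⟩, hx, -⟩ := hcell x ⟨0, hs⟩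
    exact ⟨i, hi, hx⟩
  choose f hfS hf using hp
  have := Finset.card_le_card_of_injOn (s := Finset.univ) (t := π.S) f (fun x _ => hfS x) (by
    intro x _ y _ hxy
    by_contra hne
    have hx := hf x
    have hy := hf y
    rw [hxy] at hx
    rcases lt_or_gt_of_ne hne with h | h
    · exact lt_irrefl _ (hC.lt_of_mem h hx hy)
    · exact lt_irrefl _ (hC.lt_of_mem h hy hx))
  rwa [Finset.card_univ, Fintype.card_fin] at this

/-- The cells `(x, y)` with `y ≡ 2 x` modulo `5` do not touch each other, and every line of a
`5d × 5d`-grid has at least `d` of them. One point from each gives a pattern with no `d`-close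
pair. -/
theorem five_mul_not_containsGrid {π : Permutation} {d : ℕ} (hd : 0 < d)
    (hπ : HereditarilyClose d π) {r : ℕ} (hr : 5 * d ≤ r) : ¬ π.ContainsGrid r r := by
  rintro ⟨B, C, D, hC, hD, hcell⟩
  have hp : ∀ x y : Fin r, ∃ i ∈ π.S, π.P i 0 ∈ C x ∧ π.P i 1 ∈ D y := by
    intro x y
    obtain ⟨_, ⟨i, hi, rfl⟩, hx⟩ := hcell x y
    exact ⟨i, hi, hx⟩
  choose f hfS hf0 hf1 using hp
  have hltC : ∀ {x y x' y'}, x < x' → π.P (f x y) 0 < π.P (f x' y') 0 :=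
    fun h => hC.lt_of_mem h (hf0 _ _) (hf0 _ _)
  have hltD : ∀ {x y x' y'}, y < y' → π.P (f x y) 1 < π.P (f x' y') 1 :=
    fun h => hD.lt_of_mem h (hf1 _ _) (hf1 _ _)
  have hinj : ∀ {x y x' y'}, f x y = f x' y' → x = x' ∧ y = y' := by
    intro x y x' y' h
    constructor
    · rcases lt_trichotomy x x' with hx | hx | hx
      · exact absurd (hltC (y := y) (y' := y') hx) (by rw [h]; exact lt_irrefl _)
      · exact hx
      · exact absurd (hltC (y := y') (y' := y) hx) (by rw [h]; exact lt_irrefl _)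
    · rcases lt_trichotomy y y' with hx | hx | hx
      · exact absurd (hltD (x := x) (x' := x') hx) (by rw [h]; exact lt_irrefl _)
      · exact hx
      · exact absurd (hltD (x := x') (x' := x) hx) (by rw [h]; exact lt_irrefl _)
  set L : Finset (Fin r × Fin r) := Finset.univ.filter fun c => (c.2 : ℕ) % 5 = 2 * c.1 % 5
  set T : Finset ℕ := L.image fun c => f c.1 c.2
  have hT : T ⊆ π.S := by
    intro i hi
    obtain ⟨c, -, rfl⟩ := Finset.mem_image.1 hi
    exact hfS _ _
  have hTmem : ∀ x y : Fin r, (y : ℕ) % 5 = 2 * x % 5 → f x y ∈ T := fun x y h =>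
    Finset.mem_image.2 ⟨(x, y), Finset.mem_filter.2 ⟨Finset.mem_univ _, h⟩, rfl⟩
  have hcol : ∀ x : Fin r, ∃ g : Fin d → ℕ, Function.Injective g ∧
      ∀ t, ∃ y, g t = f x y ∧ f x y ∈ T := by
    intro x
    refine ⟨fun t => f x ⟨5 * t + 2 * x % 5, by omega⟩, ?_,
      fun t => ⟨_, rfl, hTmem _ _ (by simp)⟩⟩
    intro t t' h
    have := (hinj h).2
    simp only [Fin.mk.injEq] at this
    omega
  have hrow : ∀ y : Fin r, ∃ g : Fin d → ℕ, Function.Injective g ∧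
      ∀ t, ∃ x, g t = f x y ∧ f x y ∈ T := by
    intro y
    -- The factor `3` is the inverse of `2` modulo `5`.
    refine ⟨fun t => f ⟨5 * t + 3 * y % 5, by omega⟩ y, ?_,
      fun t => ⟨_, rfl, hTmem _ _ (by simp; omega)⟩⟩
    intro t t' h
    have := (hinj h).1
    simp only [Fin.mk.injEq] at this
    omega
  have hle : ∀ (α : Fin 2) (p p' : ℕ), (∃ g : Fin d → ℕ, Function.Injective g ∧ ∀ t,
      g t ∈ T ∧ π.P p α < π.P (g t) α ∧ π.P (g t) α < π.P p' α) →
      d ≤ ((π.restrict T hT).between α p p').card ∧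
        d ≤ ((π.restrict T hT).between α p' p).card := by
    rintro α p p' ⟨g, hg, hgt⟩
    constructor <;> refine (Fintype.card_fin d).symm.le.trans (Finset.card_le_card_of_injOn
      (s := Finset.univ) g (fun t _ => (Permutation.mem_between (π := π.restrict T hT)).2
        ⟨(hgt t).1, ?_⟩) hg.injOn)
    · exact Or.inl (hgt t).2
    · exact Or.inr (hgt t).2
  -- If two columns are not adjacent, the `d` chosen points of the column after the left one lie
  -- strictly between.
  have h2C : ∀ x y x' y' : Fin r, (x : ℕ) + 1 < x' →
      d ≤ ((π.restrict T hT).between 0 (f x y) (f x' y')).card ∧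
        d ≤ ((π.restrict T hT).between 0 (f x' y') (f x y)).card := by
    intro x y x' y' h
    obtain ⟨g, hg, hgt⟩ := hcol ⟨x + 1, by omega⟩
    refine hle 0 _ _ ⟨g, hg, fun t => ?_⟩
    obtain ⟨y₁, h1, h2⟩ := hgt t
    rw [h1]
    exact ⟨h2, hltC (by rw [Fin.lt_def]; simp), hltC (by rw [Fin.lt_def]; simpa using h)⟩
  have h2D : ∀ x y x' y' : Fin r, (y : ℕ) + 1 < y' →
      d ≤ ((π.restrict T hT).between 1 (f x y) (f x' y')).card ∧
        d ≤ ((π.restrict T hT).between 1 (f x' y') (f x y)).card := by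
    intro x y x' y' h
    obtain ⟨g, hg, hgt⟩ := hrow ⟨y + 1, by omega⟩
    refine hle 1 _ _ ⟨g, hg, fun t => ?_⟩
    obtain ⟨y₁, h1, h2⟩ := hgt t
    rw [h1]
    exact ⟨h2, hltD (by rw [Fin.lt_def]; simp), hltD (by rw [Fin.lt_def]; simpa using h)⟩
  have hlen : 2 ≤ (π.restrict T hT).length := by
    have a := hTmem ⟨0, by omega⟩ ⟨0, by omega⟩ (by simp)
    have b := hTmem ⟨1, by omega⟩ ⟨2, by omega⟩ (by simp)
    refine Finset.one_lt_card.2 ⟨_, a, _, b, fun h => ?_⟩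
    simpa using (hinj h).1
  obtain ⟨p, p', hpT, hpT', hne, hlt⟩ := hπ _ (π.restrict_isSubpattern T hT) hlen
  obtain ⟨⟨x, y⟩, hxy, rfl⟩ := Finset.mem_image.1 hpT
  obtain ⟨⟨x', y'⟩, hxy', rfl⟩ := Finset.mem_image.1 hpT'
  replace hxy := (Finset.mem_filter.1 hxy).2
  replace hxy' := (Finset.mem_filter.1 hxy').2
  dsimp only at hxy hxy' hlt hne
  have hx1 : ¬ (x : ℕ) + 1 < x' := fun h => absurd (hlt 0) (h2C x y x' y' h).1.not_gt
  have hx2 : ¬ (x' : ℕ) + 1 < x := fun h => absurd (hlt 0) (h2C x' y' x y h).2.not_gt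
  have hy1 : ¬ (y : ℕ) + 1 < y' := fun h => absurd (hlt 1) (h2D x y x' y' h).1.not_gt
  have hy2 : ¬ (y' : ℕ) + 1 < y := fun h => absurd (hlt 1) (h2D x' y' x y h).2.not_gt
  have hcc : ¬ (x = x' ∧ y = y') := by
    rintro ⟨rfl, rfl⟩
    exact hne rfl
  simp only [Fin.ext_iff] at hcc
  -- If both coordinate differences are at most `1` in absolute value, then `Δy - 2 Δx` is a
  -- multiple of `5` of absolute value at most `3`, so it vanishes and forces `Δx = Δy = 0`.
  omega

/-! ### Building a decomposition from a division into strips -/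

/-- `F` can be reduced to a single rectangle by successive merges with new indices `m, m + 1, …`,
all families on the way being `D`-wide. -/
inductive CanFinish (D : ℕ) : ℕ → RectFamily → Prop
  | single {m : ℕ} {F : RectFamily} (hF : F.IsWide D) (h : F.S.card = 1) : CanFinish D m F
  | merge {m : ℕ} {F : RectFamily} (hF : F.IsWide D) {i j : ℕ} (hi : i ∈ F.S) (hj : j ∈ F.S)
      (hij : i ≠ j) (h : CanFinish D (m + 1) (F.merge i j m)) : CanFinish D m F

theorem CanFinish.exists_sequence {D m : ℕ} {F : RectFamily} (h : CanFinish D m F) :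
    ∃ (s : ℕ) (fam : Fin (s + 1) → RectFamily) (k : Fin s → ℕ), fam 0 = F ∧ StrictMono k ∧
      (∀ p, m ≤ k p) ∧
      (∀ p : Fin s, ∃ i ∈ (fam p.castSucc).S, ∃ j ∈ (fam p.castSucc).S, i ≠ j ∧
        fam p.succ = (fam p.castSucc).merge i j (k p)) ∧
      (fam (Fin.last s)).S.card = 1 ∧ ∀ p, (fam p).IsWide D := by
  induction h with
  | @single m F hF h =>
    exact ⟨0, fun _ => F, Fin.elim0, rfl, fun a => a.elim0, fun a => a.elim0, fun a => a.elim0,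
      h, fun _ => hF⟩
  | @merge m F hF i j hi hj hij h ih =>
    obtain ⟨s, fam, k, h0, hk, hkm, hstep, hlast, hwide⟩ := ih
    refine ⟨s + 1, Fin.cons F fam, Fin.cons m k, rfl, ?_, ?_, ?_, ?_, ?_⟩
    · intro a b hab
      induction b using Fin.cases with
      | zero => exact absurd hab (Fin.not_lt_zero _)
      | succ b =>
        induction a using Fin.cases with
        | zero => simpa using Nat.lt_of_succ_le (hkm b)
        | succ a => simpa using hk (Fin.succ_lt_succ_iff.1 hab)
    · intro a
      induction a using Fin.cases with
      | zero => simp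
      | succ a => simpa using (Nat.le_succ m).trans (hkm a)
    · intro a
      induction a using Fin.cases with
      | zero => exact ⟨i, hi, j, hj, hij, by simpa using h0⟩
      | succ a => simpa [Fin.castSucc_succ] using hstep a
    · rw [← Fin.succ_last]
      exact hlast
    · intro a
      induction a using Fin.cases with
      | zero => simpa using hF
      | succ a => simpa using hwide a

theorem CanFinish.hasWideDecomposition {D m : ℕ} {π : Permutation} (hm : ∀ i ∈ π.S, i < m)
    (h : CanFinish D m π.toFamily) : HasWideDecomposition D π := by
  obtain ⟨s, fam, k, h0, hk, hkm, hstep, hlast, hwide⟩ := h.exists_sequence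
  exact ⟨s, fam, ⟨h0, ⟨k, hk, fun p i hi => (hm i hi).trans_le (hkm p), hstep⟩, hlast⟩, hwide⟩

/-- The strip of the division `c` of the `α`-th axis that contains the rectangle `A`. -/
def strip (c : Fin 2 → ℕ → ℕ) (α : Fin 2) (A : Rect) : ℕ := c α (A α).fst

/-- The number of rectangles in the `v`-th strip of the `α`-th axis. -/
def load (c : Fin 2 → ℕ → ℕ) (F : RectFamily) (α : Fin 2) (v : ℕ) : ℕ :=
  (F.S.filter fun i => strip c α (F.R i) = v).card

/-- A family of rectangles that covers points of `Q` and is compatible with the division of the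
two axes into `n 0` and `n 1` strips, each of which carries at most `D` rectangles. -/
structure IsDivided (Q : Set (ℕ × ℕ)) (D : ℕ) (c : Fin 2 → ℕ → ℕ) (n : Fin 2 → ℕ)
    (F : RectFamily) : Prop where
  mono : ∀ α, Monotone (c α)
  nonempty : F.S.Nonempty
  within : ∀ i ∈ F.S, ∀ α, c α (F.R i α).snd = strip c α (F.R i)
  lt : ∀ i ∈ F.S, ∀ α, strip c α (F.R i) < n α
  covers : ∀ i ∈ F.S, ∃ p ∈ Q, p.1 ∈ F.R i 0 ∧ p.2 ∈ F.R i 1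
  load_le : ∀ α v, load c F α v ≤ D

namespace IsDivided

variable {Q : Set (ℕ × ℕ)} {D : ℕ} {c : Fin 2 → ℕ → ℕ} {n : Fin 2 → ℕ} {F : RectFamily}

theorem strip_eq (h : IsDivided Q D c n F) {i : ℕ} (hi : i ∈ F.S) {α : Fin 2} {x : ℕ}
    (hx : x ∈ F.R i α) : c α x = strip c α (F.R i) :=
  le_antisymm ((h.mono α hx.2).trans (h.within i hi α).le) (h.mono α hx.1)

/-- Rectangles that view each other lie in the same strip. The strict inequality comes from the
rectangle itself, which is counted in the load but not in its view. -/
theorem isWide (h : IsDivided Q D c n F) : F.IsWide D := by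
  intro i hi
  have key : ∀ α, (F.viewSet α i).card < D := by
    intro α
    refine lt_of_lt_of_le (Finset.card_lt_card ?_) (h.load_le α (strip c α (F.R i)))
    refine ⟨fun j hj => ?_, fun hsub => ?_⟩
    · obtain ⟨⟨-, hj⟩, x, hx1, hx2⟩ := RectFamily.mem_viewSet.1 hj
      exact Finset.mem_filter.2 ⟨hj, (h.strip_eq hj hx2).symm.trans (h.strip_eq hi hx1)⟩
    · exact (RectFamily.mem_viewSet.1 (hsub (Finset.mem_filter.2 ⟨hi, rfl⟩))).1.1 rfl
  exact max_lt (key 0) (key 1)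

theorem strip_merge (h : IsDivided Q D c n F) {i j : ℕ} (hi : i ∈ F.S) (hj : j ∈ F.S)
    (hs : ∀ α, strip c α (F.R i) = strip c α (F.R j)) (α : Fin 2) :
    strip c α (F.R i ⊔ F.R j) = strip c α (F.R i) ∧
      c α ((F.R i ⊔ F.R j) α).snd = strip c α (F.R i) := by
  constructor
  · change c α ((F.R i α).fst ⊓ (F.R j α).fst) = _
    rw [(h.mono α).map_inf]
    change strip c α (F.R i) ⊓ strip c α (F.R j) = _
    rw [← hs α, inf_idem]
  · change c α ((F.R i α).snd ⊔ (F.R j α).snd) = _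
    rw [(h.mono α).map_sup, h.within i hi, h.within j hj, ← hs α, sup_idem]

theorem merge (h : IsDivided Q D c n F) {i j m : ℕ} (hi : i ∈ F.S) (hj : j ∈ F.S) (hm : m ∉ F.S)
    (hs : ∀ α, strip c α (F.R i) = strip c α (F.R j)) :
    IsDivided Q D c n (F.merge i j m) := by
  have hRm : (F.merge i j m).R m = F.R i ⊔ F.R j := Function.update_self ..
  have hRn : ∀ x ∈ F.S, (F.merge i j m).R x = F.R x := fun x hx =>
    Function.update_of_ne (by rintro rfl; exact hm hx) ..
  have hS : ∀ x ∈ (F.merge i j m).S, x = m ∨ x ∈ F.S := by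
    intro x hx
    rcases Finset.mem_insert.1 hx with hx | hx
    · exact Or.inl hx
    · exact Or.inr (Finset.mem_sdiff.1 hx).1
  have hsm := h.strip_merge hi hj hs
  refine ⟨h.mono, ⟨m, Finset.mem_insert_self _ _⟩, ?_, ?_, ?_, ?_⟩
  · intro x hx α
    rcases hS x hx with rfl | hx
    · rw [hRm, (hsm α).1, (hsm α).2]
    · rw [hRn x hx, h.within x hx]
  · intro x hx α
    rcases hS x hx with rfl | hx
    · rw [hRm, (hsm α).1]
      exact h.lt i hi α
    · rw [hRn x hx]
      exact h.lt x hx α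
  · intro x hx
    rcases hS x hx with rfl | hx
    · obtain ⟨p, hp, h0, h1⟩ := h.covers i hi
      rw [hRm]
      exact ⟨p, hp, Rect.mem_sup_left h0, Rect.mem_sup_left h1⟩
    · rw [hRn x hx]
      exact h.covers x hx
  · intro α v
    -- The new rectangle takes the place of `i`, which has left the family and lay in the same
    -- strips, so no load grows.
    refine le_trans (Finset.card_le_card_of_injOn (fun x => if x = m then i else x) ?_ ?_)
      (h.load_le α v)
    · intro x hx
      obtain ⟨hxS, hxv⟩ := Finset.mem_filter.1 hx
      dsimp only
      split_ifs with hxm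
      · rw [hxm, hRm, (hsm α).1] at hxv
        exact Finset.mem_filter.2 ⟨hi, hxv⟩
      · have hxF := (hS x hxS).resolve_left hxm
        rw [hRn x hxF] at hxv
        exact Finset.mem_filter.2 ⟨hxF, hxv⟩
    · have hi' : ∀ x ∈ (F.merge i j m).S, x ≠ m → x ≠ i := by
        intro x hx hxm
        have := (Finset.mem_sdiff.1 ((Finset.mem_insert.1 hx).resolve_left hxm)).2
        simp only [Finset.mem_insert, not_or] at this
        exact this.1
      intro x hx y hy hxy
      have hx' := hi' x (Finset.mem_filter.1 hx).1
      have hy' := hi' y (Finset.mem_filter.1 hy).1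
      grind

end IsDivided

theorem card_merge_lt {F : RectFamily} {i j m : ℕ} (hi : i ∈ F.S) (hj : j ∈ F.S) (hij : i ≠ j) :
    (F.merge i j m).S.card < F.S.card := by
  have h1 : (F.merge i j m).S.card ≤ (F.S \ {i, j}).card + 1 := Finset.card_insert_le _ _
  have h2 : ({i, j} : Finset ℕ) ⊆ F.S := by
    intro x hx
    simp only [Finset.mem_insert, Finset.mem_singleton] at hx
    rcases hx with rfl | rfl <;> assumption
  have h3 := Finset.card_sdiff_add_card_eq_card h2
  rw [Finset.card_pair hij] at h3
  omega

/-- The map identifying the strips `v` and `v + 1`. -/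
def joinStrips (v x : ℕ) : ℕ := if x ≤ v then x else x - 1

theorem joinStrips_monotone (v : ℕ) : Monotone (joinStrips v) := by
  intro a b hab
  simp only [joinStrips]
  split_ifs <;> omega

theorem IsDivided.join {Q : Set (ℕ × ℕ)} {D : ℕ} {c : Fin 2 → ℕ → ℕ} {n : Fin 2 → ℕ}
    {F : RectFamily} (h : IsDivided Q D c n F) {β : Fin 2} {v : ℕ} (hv : v + 1 < n β)
    (hload : load c F β v + load c F β (v + 1) ≤ D) :
    IsDivided Q D (Function.update c β (joinStrips v ∘ c β)) (Function.update n β (n β - 1)) F := by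
  set c' := Function.update c β (joinStrips v ∘ c β) with hc'
  have hself : c' β = joinStrips v ∘ c β := Function.update_self ..
  have hne : ∀ α ≠ β, c' α = c α := fun α hα => Function.update_of_ne hα ..
  refine ⟨fun α => ?_, h.nonempty, fun i hi α => ?_, fun i hi α => ?_, h.covers, fun α w => ?_⟩ <;>
    rcases eq_or_ne α β with rfl | hα
  · rw [hself]
    exact (joinStrips_monotone v).comp (h.mono α)
  · rw [hne α hα]
    exact h.mono α
  · have := h.within i hi α
    simp only [strip, hself, Function.comp_apply] at this ⊢
    rw [this]
  · have := h.within i hi α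
    simp only [strip, hne α hα] at this ⊢
    exact this
  · have := h.lt i hi α
    simp only [strip, hself, Function.comp_apply, Function.update_self, joinStrips] at this ⊢
    split_ifs <;> omega
  · have := h.lt i hi α
    simp only [strip, hne α hα, Function.update_of_ne hα] at this ⊢
    exact this
  · have hsub : ∀ a b : ℕ, (∀ x, joinStrips v x = w → x = a ∨ x = b) →
        load c' F α w ≤ load c F α a + load c F α b := by
      intro a b hab
      refine (Finset.card_le_card fun i hi => ?_).trans (Finset.card_union_le _ _)
      obtain ⟨hi, hw⟩ := Finset.mem_filter.1 hi
      simp only [strip, hself, Function.comp_apply] at hw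
      exact Finset.mem_union.2 ((hab _ hw).imp (fun e => Finset.mem_filter.2 ⟨hi, e⟩)
        fun e => Finset.mem_filter.2 ⟨hi, e⟩)
    have hone : ∀ a : ℕ, (∀ x, joinStrips v x = w → x = a) → load c' F α w ≤ load c F α a := by
      intro a ha
      refine Finset.card_le_card fun i hi => ?_
      obtain ⟨hi, hw⟩ := Finset.mem_filter.1 hi
      simp only [strip, hself, Function.comp_apply] at hw
      exact Finset.mem_filter.2 ⟨hi, ha _ hw⟩
    rcases lt_trichotomy w v with hw | rfl | hw
    · refine (hone w fun x hx => ?_).trans (h.load_le α w)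
      simp only [joinStrips] at hx
      split_ifs at hx <;> omega
    · refine (hsub w (w + 1) fun x hx => ?_).trans hload
      simp only [joinStrips] at hx
      split_ifs at hx <;> omega
    · refine (hone (w + 1) fun x hx => ?_).trans (h.load_le α _)
      simp only [joinStrips] at hx
      split_ifs at hx <;> omega
  · refine (Finset.card_le_card fun i hi => ?_).trans (h.load_le α w)
    obtain ⟨hi, hw⟩ := Finset.mem_filter.1 hi
    simp only [strip, hne α hα] at hw
    exact Finset.mem_filter.2 ⟨hi, hw⟩

/-- Averaging: the `n - 1` adjacent pairs have total load at most `2 C n`, and `n ≤ 2 (n - 1)`. This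
is the origin of the load bound `4 * C`. -/
theorem exists_load_add_load_le {c : Fin 2 → ℕ → ℕ} {F : RectFamily} {β : Fin 2} {n C : ℕ}
    (hn : 2 ≤ n) (hlt : ∀ i ∈ F.S, strip c β (F.R i) < n) (hcard : F.S.card ≤ C * n) :
    ∃ v, v + 1 < n ∧ load c F β v + load c F β (v + 1) ≤ 4 * C := by
  have htot : F.S.card = ∑ v ∈ Finset.range n, load c F β v :=
    Finset.card_eq_sum_card_fiberwise fun i hi => Finset.mem_coe.2 (Finset.mem_range.2 (hlt i hi))
  obtain ⟨k, rfl⟩ : ∃ k, n = k + 1 := ⟨n - 1, by omega⟩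
  have h1 := Finset.sum_range_succ (load c F β) k
  have h2 := Finset.sum_range_succ' (load c F β) k
  have hsum : ∑ v ∈ Finset.range k, (load c F β v + load c F β (v + 1)) ≤
      ∑ v ∈ Finset.range k, 4 * C := by
    rw [Finset.sum_add_distrib, Finset.sum_const, Finset.card_range, smul_eq_mul]
    have : C * (k + 1) ≤ C * (2 * k) := Nat.mul_le_mul_left _ (by omega)
    nlinarith
  obtain ⟨v, hv, hle⟩ := Finset.exists_le_of_sum_le ⟨0, Finset.mem_range.2 (by omega)⟩ hsum
  exact ⟨v, by have := Finset.mem_range.1 hv; omega, hle⟩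

/-- Induction on the number of strips plus the number of rectangles: either two rectangles in a
common cell are merged, or two adjacent strips are joined. Joining leaves the family unchanged, so
only merges appear in the decomposition. -/
theorem IsDivided.canFinish {Q : Set (ℕ × ℕ)} {r C : ℕ} (hQ : ¬ HasGridMinor Q r)
    (hC : ∀ (n : ℕ) (M : Finset (ℕ × ℕ)), M ⊆ Finset.range n ×ˢ Finset.range n →
      ¬ HasGridMinor (M : Set (ℕ × ℕ)) r → M.card ≤ C * n) (N : ℕ) :
    ∀ (m : ℕ) (c : Fin 2 → ℕ → ℕ) (n : Fin 2 → ℕ) (F : RectFamily), n 0 + n 1 + F.S.card = N →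
      IsDivided Q (4 * C) c n F → (∀ i ∈ F.S, i < m) → CanFinish (4 * C) m F := by
  induction N using Nat.strong_induction_on with
  | _ N ih =>
    rintro m c n F rfl h hm
    by_cases hinj : ∃ i ∈ F.S, ∃ j ∈ F.S, i ≠ j ∧ ∀ α, strip c α (F.R i) = strip c α (F.R j)
    · obtain ⟨i, hi, j, hj, hij, hs⟩ := hinj
      refine .merge h.isWide hi hj hij (ih _ ?_ (m + 1) c n _ rfl
        (h.merge hi hj (fun hmS => lt_irrefl _ (hm m hmS)) hs) fun x hx => ?_)
      · have := card_merge_lt (m := m) hi hj hij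
        omega
      · rcases Finset.mem_insert.1 hx with rfl | hx
        · exact Nat.lt_succ_self _
        · exact (hm x (Finset.mem_sdiff.1 hx).1).trans (Nat.lt_succ_self _)
    · push Not at hinj
      by_cases hcard : F.S.card ≤ 1
      · exact .single h.isWide (le_antisymm hcard h.nonempty.card_pos)
      -- The axis with more strips is shortened, since the matrix of occupied cells fits into a
      -- square of that side.
      obtain ⟨β, hβ⟩ : ∃ β, ∀ α, n α ≤ n β := by
        rcases le_total (n 0) (n 1) with hle | hle
        · exact ⟨1, fun α => by fin_cases α <;> simp [hle]⟩
        · exact ⟨0, fun α => by fin_cases α <;> simp [hle]⟩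
      have hcell : Set.InjOn (fun i => (strip c 0 (F.R i), strip c 1 (F.R i))) (F.S : Set ℕ) := by
        intro i hi j hj hij
        by_contra hne
        obtain ⟨α, hα⟩ := hinj i hi j hj hne
        rw [Prod.mk.injEq] at hij
        fin_cases α
        · exact hα hij.1
        · exact hα hij.2
      have hle : F.S.card ≤ C * n β := by
        rw [← Finset.card_image_of_injOn hcell]
        refine hC _ _ (fun p hp => ?_) fun hgrid => hQ ?_
        · obtain ⟨i, hi, rfl⟩ := Finset.mem_image.1 hp
          simp only [Finset.mem_product, Finset.mem_range]
          exact ⟨(h.lt i hi 0).trans_le (hβ 0), (h.lt i hi 1).trans_le (hβ 1)⟩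
        -- Every occupied cell contains a point of `Q`, so a grid minor among the cells pulls back
        -- to `Q` along the division maps.
        · obtain ⟨u, v, hu, hv, hgrid⟩ := hgrid
          refine ⟨u ∘ c 0, v ∘ c 1, hu.comp (h.mono 0), hv.comp (h.mono 1), fun a ha b hb => ?_⟩
          obtain ⟨q, hq, rfl, rfl⟩ := hgrid a ha b hb
          obtain ⟨i, hi, rfl⟩ := Finset.mem_image.1 (Finset.mem_coe.1 hq)
          obtain ⟨p, hp, h0, h1⟩ := h.covers i hi
          exact ⟨p, hp, congrArg u (h.strip_eq hi h0), congrArg v (h.strip_eq hi h1)⟩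
      have hn : 2 ≤ n β := by
        by_contra! hlt
        obtain ⟨i, hi, j, hj, hij⟩ := Finset.one_lt_card.1 (not_le.1 hcard)
        obtain ⟨α, hα⟩ := hinj i hi j hj hij
        have h1 := h.lt i hi α
        have h2 := h.lt j hj α
        have h3 := hβ α
        omega
      obtain ⟨v, hv, hload⟩ := exists_load_add_load_le hn (fun i hi => h.lt i hi β) hle
      refine ih _ ?_ m _ _ F rfl (h.join hv hload) hm
      have hsum : ∀ f : Fin 2 → ℕ, f 0 + f 1 = ∑ α, f α := fun f => (Fin.sum_univ_two f).symm
      rw [hsum, hsum]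
      refine Nat.add_lt_add_right (Finset.sum_lt_sum (fun α _ => ?_) ⟨β, Finset.mem_univ _, ?_⟩) _
      · rcases eq_or_ne α β with rfl | hα
        · rw [Function.update_self]; omega
        · rw [Function.update_of_ne hα]
      · rw [Function.update_self]; omega

/-! ### Bounding the width by the grid measure -/

/-- The points of `π` as pairs. -/
def Permutation.pairs (π : Permutation) : Set (ℕ × ℕ) :=
  {q | ∃ i ∈ π.S, q = (π.P i 0, π.P i 1)}

/-- Start with every coordinate value as its own strip. General position makes all loads at most
`1`, and `C > 0` ensures that this is within `4 * C`. -/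
theorem exists_hasWideDecomposition (r : ℕ) : ∃ D, ∀ π : Permutation, 1 ≤ π.length →
    ¬ HasGridMinor π.pairs r → HasWideDecomposition D π := by
  obtain ⟨C, hC0, hC⟩ := exists_card_le_mul_of_not_hasGridMinor r
  refine ⟨4 * C, fun π hπ hgrid => ?_⟩
  refine CanFinish.hasWideDecomposition (m := π.S.sup id + 1)
    (fun i hi => Nat.lt_succ_of_le (Finset.le_sup (f := id) hi)) ?_
  refine IsDivided.canFinish hgrid hC _ _ (fun _ => id)
    (fun α => π.S.sup (fun i => π.P i α) + 1) _ rfl ?_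
    (fun i hi => Nat.lt_succ_of_le (Finset.le_sup (f := id) hi))
  refine ⟨fun _ => monotone_id, Finset.card_pos.1 hπ, fun i hi α => rfl, fun i hi α =>
    Nat.lt_succ_of_le (Finset.le_sup (f := fun i => π.P i α) hi), fun i hi => ?_, fun α v => ?_⟩
  · exact ⟨_, ⟨i, hi, rfl⟩, NonemptyInterval.mem_pure.2 rfl, NonemptyInterval.mem_pure.2 rfl⟩
  · refine le_trans (Finset.card_le_one.2 fun i hi j hj => ?_) (by omega : 1 ≤ 4 * C)
    obtain ⟨hi, hiv⟩ := Finset.mem_filter.1 hi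
    obtain ⟨hj, hjv⟩ := Finset.mem_filter.1 hj
    exact π.general α hi hj (hiv.trans hjv.symm)

/-- The fibres of a monotone map are intervals, which turns grid minors into genuine grids. -/
theorem exists_isIntervalPartition_of_monotone {r N : ℕ} (hr : 0 < r) {u : ℕ → ℕ}
    (hu : Monotone u) (hsurj : ∀ i < r, ∃ x ≤ N, u x = i) :
    ∃ Q : Fin r → NonemptyInterval ℕ,
      IsIntervalPartition ⟨(0, N), Nat.zero_le N⟩ Q ∧
        ∀ (i : Fin r) (x : ℕ), x ≤ N → u x = i → x ∈ Q i := by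
  -- Truncation puts all values from `r - 1` on into the last class, so that the `r` fibres cover
  -- all of `[0, N]`.
  set w : ℕ → ℕ := fun x => min (u x) (r - 1) with hw
  have hwm : Monotone w := fun a b hab => min_le_min_right _ (hu hab)
  set T : Fin r → Finset ℕ := fun i => (Finset.range (N + 1)).filter fun x => w x = i with hT
  have hmemT : ∀ i x, x ∈ T i ↔ x ≤ N ∧ w x = i := by
    intro i x
    simp [hT]
  have hne : ∀ i, (T i).Nonempty := by
    intro i
    obtain ⟨x, hx, hxi⟩ := hsurj i i.2
    exact ⟨x, (hmemT i x).2 ⟨hx, by simp only [hw]; omega⟩⟩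
  set Q : Fin r → NonemptyInterval ℕ := fun i =>
    ⟨((T i).min' (hne i), (T i).max' (hne i)),
      Finset.min'_le _ _ (Finset.max'_mem (T i) (hne i))⟩ with hQ
  have hmemQ : ∀ i x, x ∈ Q i ↔ x ≤ N ∧ w x = i := by
    intro i x
    constructor
    · rintro ⟨h1, h2⟩
      have a := (hmemT i _).1 ((T i).min'_mem (hne i))
      have b := (hmemT i _).1 ((T i).max'_mem (hne i))
      exact ⟨h2.trans b.1, le_antisymm ((hwm h2).trans b.2.le) (a.2.ge.trans (hwm h1))⟩
    · intro h
      exact ⟨Finset.min'_le _ _ ((hmemT i x).2 h), Finset.le_max' _ _ ((hmemT i x).2 h)⟩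
  refine ⟨Q, ⟨fun a b hab => Set.disjoint_left.2 fun x hx hy => hab ?_, ?_, fun a b hab => ?_⟩, ?_⟩
  · exact Fin.ext (((hmemQ a x).1 hx).2.symm.trans ((hmemQ b x).1 hy).2)
  · ext x
    rw [Set.mem_iUnion]
    constructor
    · rintro ⟨i, hi⟩
      exact ⟨Nat.zero_le _, ((hmemQ i x).1 hi).1⟩
    · rintro ⟨-, hx⟩
      exact ⟨⟨w x, by simp only [hw]; omega⟩, (hmemQ _ x).2 ⟨hx, rfl⟩⟩
  · refine hwm.reflect_lt ?_
    have a := ((hmemQ a _).1 ⟨(Q a).fst_le_snd, le_rfl⟩).2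
    have b := ((hmemQ b _).1 ⟨le_rfl, (Q b).fst_le_snd⟩).2
    rw [a, b]
    exact hab
  · intro i x hx hxi
    exact (hmemQ i x).2 ⟨hx, by simp only [hw]; omega⟩

theorem containsGrid_of_hasGridMinor {π : Permutation} {r : ℕ} (hr : 0 < r)
    (h : HasGridMinor π.pairs r) : π.ContainsGrid r r := by
  obtain ⟨u, v, hu, hv, h⟩ := h
  have hN : ∀ α, ∀ i ∈ π.S, π.P i α ≤ π.S.sup fun i => π.P i α := fun α i hi =>
    Finset.le_sup (f := fun i => π.P i α) hi
  obtain ⟨C, hC, hC'⟩ := exists_isIntervalPartition_of_monotone hr hu (N := π.S.sup fun i => π.P i 0)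
    (fun a ha => by
      obtain ⟨_, ⟨i, hi, rfl⟩, h1, -⟩ := h a ha 0 hr
      exact ⟨_, hN 0 i hi, h1⟩)
  obtain ⟨D, hD, hD'⟩ := exists_isIntervalPartition_of_monotone hr hv (N := π.S.sup fun i => π.P i 1)
    (fun a ha => by
      obtain ⟨_, ⟨i, hi, rfl⟩, -, h1⟩ := h 0 hr a ha
      exact ⟨_, hN 1 i hi, h1⟩)
  refine ⟨![_, _], C, D, hC, hD, fun x y => ?_⟩
  obtain ⟨_, ⟨i, hi, rfl⟩, h1, h2⟩ := h x x.2 y y.2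
  exact ⟨π.P i, ⟨i, hi, rfl⟩, hC' x _ (hN 0 i hi) h1, hD' y _ (hN 1 i hi) h2⟩

theorem containsGrid_one {π : Permutation} (hπ : 1 ≤ π.length) : π.ContainsGrid 1 1 := by
  obtain ⟨i, hi⟩ := Finset.card_pos.1 hπ
  refine containsGrid_of_hasGridMinor one_pos ⟨fun _ => 0, fun _ => 0, monotone_const,
    monotone_const, fun a ha b hb => ⟨_, ⟨i, hi, rfl⟩, by dsimp only; omega, by dsimp only; omega⟩⟩

theorem isGreatest_gridMeasure {π : Permutation} (hπ : 1 ≤ π.length) :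
    IsGreatest {r | π.ContainsGrid r r} (gridMeasure π) := by
  have hbdd : BddAbove {r | π.ContainsGrid r r} := by
    refine ⟨π.length, fun r hr => ?_⟩
    rcases Nat.eq_zero_or_pos r with rfl | h0
    · exact Nat.zero_le _
    · exact card_le_length_of_containsGrid h0 hr
  exact ⟨Nat.sSup_mem ⟨1, containsGrid_one hπ⟩ hbdd, fun r hr => le_csSup hbdd hr⟩

/-- The width of a permutation is bounded by a function of its grid measure. -/
theorem exists_hasWideDecomposition_gridMeasure : ∃ W : ℕ → ℕ, ∀ π : Permutation,
    1 ≤ π.length → HasWideDecomposition (W (gridMeasure π)) π := by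
  choose W hW using fun n => exists_hasWideDecomposition (n + 1)
  refine ⟨W, fun π hπ => hW _ π hπ fun h => ?_⟩
  exact Nat.not_succ_le_self _
    ((isGreatest_gridMeasure hπ).2 (containsGrid_of_hasGridMinor (Nat.succ_pos _) h))

/-! ### Well-definedness and the cycle of inequalities -/

theorem isLeast_width {π : Permutation} (hπ : 1 ≤ π.length) :
    IsLeast {d | HasWideDecomposition d π} (width π) := by
  obtain ⟨W, hW⟩ := exists_hasWideDecomposition_gridMeasure
  exact ⟨Nat.sInf_mem ⟨_, hW π hπ⟩, fun d hd => Nat.sInf_le hd⟩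

theorem HasWideDecomposition.pos {d : ℕ} {π : Permutation} (h : HasWideDecomposition d π) :
    0 < d := by
  obtain ⟨s, fam, ⟨-, -, hlast⟩, hwide⟩ := h
  obtain ⟨i, hi⟩ := Finset.card_pos.1 (hlast.symm ▸ one_pos)
  exact Nat.zero_lt_of_lt (hwide _ i hi)

theorem isLeast_closeMeasure {π : Permutation} (hπ : 1 ≤ π.length) :
    IsLeast {d | 0 < d ∧ HereditarilyClose d π} (closeMeasure π) := by
  have hw := (isLeast_width hπ).1
  exact ⟨Nat.sInf_mem ⟨_, hw.pos, hw.hereditarilyClose⟩, fun d hd => Nat.sInf_le hd⟩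

theorem closeMeasure_le_width {π : Permutation} (hπ : 1 ≤ π.length) :
    closeMeasure π ≤ width π := by
  have hw := (isLeast_width hπ).1
  exact (isLeast_closeMeasure hπ).2 ⟨hw.pos, hw.hereditarilyClose⟩

theorem gridMeasure_lt {π : Permutation} (hπ : 1 ≤ π.length) :
    gridMeasure π < 5 * closeMeasure π := by
  by_contra! h
  have hc := (isLeast_closeMeasure hπ).1
  exact five_mul_not_containsGrid hc.1 hc.2 h (isGreatest_gridMeasure hπ).1

theorem exists_width_le : ∃ H : ℕ → ℕ, StrictMono H ∧ ∀ π : Permutation, 1 ≤ π.length →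
    width π ≤ H (gridMeasure π) := by
  obtain ⟨W, hW⟩ := exists_hasWideDecomposition_gridMeasure
  -- Partial sums with an added `1` per term give a strictly increasing majorant of the arbitrary
  -- bound `W`.
  refine ⟨fun n => ∑ i ∈ Finset.range (n + 1), (W i + 1), strictMono_nat_of_lt_succ fun n => ?_,
    fun π hπ => ?_⟩
  · rw [Finset.sum_range_succ _ (n + 1)]
    omega
  · refine ((isLeast_width hπ).2 (hW π hπ)).trans ?_
    dsimp only
    rw [Finset.sum_range_succ]
    omega

theorem strictMono_five_mul : StrictMono fun n : ℕ => 5 * n :=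
  fun a b hab => by dsimp only; omega

end PermPattern

theorem mainTheorem5 :
    (∀ π : PermPattern.Permutation, 1 ≤ π.length →
      IsGreatest {r | π.ContainsGrid r r} (PermPattern.gridMeasure π) ∧
      IsLeast {d | 0 < d ∧ PermPattern.HereditarilyClose d π} (PermPattern.closeMeasure π) ∧
      IsLeast {d | PermPattern.HasWideDecomposition d π} (PermPattern.width π)) ∧
    PermPattern.EquivalentMeasures PermPattern.gridMeasure PermPattern.closeMeasure ∧
    PermPattern.EquivalentMeasures PermPattern.gridMeasure PermPattern.width ∧
    PermPattern.EquivalentMeasures PermPattern.closeMeasure PermPattern.width ∧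
    (∀ π : PermPattern.Permutation, 1 ≤ π.length →
      PermPattern.closeMeasure π ≤ PermPattern.width π ∧
      PermPattern.gridMeasure π < 5 * PermPattern.closeMeasure π) := by
  open PermPattern in
  obtain ⟨H, hH, hwH⟩ := exists_width_le
  refine ⟨fun π hπ => ⟨isGreatest_gridMeasure hπ, isLeast_closeMeasure hπ, isLeast_width hπ⟩,
    ⟨_, H, strictMono_five_mul, hH, fun π hπ => ⟨(gridMeasure_lt hπ).le,
      (closeMeasure_le_width hπ).trans (hwH π hπ)⟩⟩,
    ⟨_, H, strictMono_five_mul, hH, fun π hπ => ⟨(gridMeasure_lt hπ).le.trans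
      (Nat.mul_le_mul_left 5 (closeMeasure_le_width hπ)), hwH π hπ⟩⟩,
    ⟨id, _, strictMono_id, hH.comp strictMono_five_mul, fun π hπ => ⟨closeMeasure_le_width hπ,
      (hwH π hπ).trans (hH.monotone (gridMeasure_lt hπ).le)⟩⟩,
    fun π hπ => ⟨closeMeasure_le_width hπ, gridMeasure_lt hπ⟩⟩
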